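/- A \emph{1-linkoid diagram} $L$ is a generic immersion in the plane of an oriented interval and finitely many oriented circles (finitely many transverse double points, none of them at an endpoint) with over/under information at each double point; its \emph{leg} and \emph{head} are the initial and terminal points of the interval. Its \emph{fundamental quandle} $Q(L)$ has one generator for each arc (between consecutive underpasses) and the relation $c=a\triangleright b$ at each crossing, where $b$ is the over-arc and $a$, $c$ are the under-arcs on the right and on the left of $b$. Its \emph{fundamental pointed quandle} is $P(L)=(Q(L),l,h)$, where $l$ and $h$ are the generators of the arcs adjacent to the leg and to the head. The diagram $L$ is of \emph{link-type} if its leg and head lie in the same region of the diagram. An \emph{under-closure} $L_-$ of $L$ is a link diagram obtained by joining the head to the leg by an arc without self-crossings that meets $L$ only in transverse crossings away from the endpoints and passes under at each of them; for a link-type diagram the arc is taken inside the common region, so that no crossing is created. If the closing arc passes successively under the arcs $b_1,\dots,b_k$ of $L$, let $f=\beta_{b_k}^{\varepsilon_k}\circ\cdots\circ\beta_{b_1}^{\varepsilon_1}\in\mathrm{Inn}(Q(L))$, where $\beta_b(x)=x\triangleright b$, and $\varepsilon_i=1$ if the closing arc passes under $b_i$ from right to left and $\varepsilon_i=-1$ otherwise;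 thus $f$ records the forbidden under moves that bring the head along the closing arc into the region of the leg, and $f(h)=l$ is called the closing relation of $L$. (1) Let $L$ and $L'$ be link-type 1-linkoid diagrams with closures $L_-$ and $L'_-$. If $P(L)\cong P(L')$ as pointed quandles, then $Q(L_-)\cong Q(L'_-)$. (2) Let $L$ and $L'$ be arbitrary 1-linkoid diagrams with under-closures $L_-$ and $L'_-$, and let $f(h)=l$ and $g(h')=l'$ be the corresponding closing relations. If there is an isomorphism of pointed quandles $(Q(L),l,f(h))\to(Q(L'),l',g(h'))$, then $Q(L_-)\cong Q(L'_-)$. -/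

import Mathlib

open scoped ContDiff

noncomputable section

/- ### Quandles, presentations, pointed quandles

We use Mathlib's `Quandle`, whose operation `b ◃ a` is a left action: it is what is written
`a ▷ b` (`b` acts on `a`) in the right-action convention. -/

/-- An isomorphism of quandles. -/
structure QuandleIso (X Y : Type) [Quandle X] [Quandle Y] extends X ≃ Y where
  map_act : ∀ x y : X, toFun (Shelf.act x y) = Shelf.act (toFun x) (toFun y)

/-- A `k`-pointed quandle: a quandle with an ordered `k`-tuple of elements. -/
structure PointedQuandle (k : ℕ) where
  carrier : Type
  [quandle : Quandle carrier]
  base : Fin k → carrier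

attribute [instance] PointedQuandle.quandle

/-- An isomorphism of `k`-pointed quandles: an isomorphism of the underlying quandles that maps
the `i`-th basepoint to the `i`-th basepoint. -/
structure PointedQuandleIso {k : ℕ} (X Y : PointedQuandle k)
    extends QuandleIso X.carrier Y.carrier where
  map_base : ∀ i : Fin k, toFun (X.base i) = Y.base i

/-- The group of inner automorphisms of a quandle, generated by the maps `β_x = (x ◃ ·)`. -/
def QuandleInn (X : Type) [Quandle X] : Subgroup (Equiv.Perm X) :=
  Subgroup.closure (Set.range fun x : X => (Rack.act' x : Equiv.Perm X))

/-- The inner automorphism `β_x`. -/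
def quandleBeta {X : Type} [Quandle X] (x : X) : QuandleInn X :=
  ⟨Rack.act' x, Subgroup.subset_closure ⟨x, rfl⟩⟩

/-- Formal quandle words in the letters `G`. -/
inductive QuandleWord (G : Type) : Type
  | gen : G → QuandleWord G
  | act : QuandleWord G → QuandleWord G → QuandleWord G
  | invAct : QuandleWord G → QuandleWord G → QuandleWord G

/-- The congruence on words generated by the quandle axioms and the relations `r`. -/
inductive QuandleWord.Rel {G : Type} (r : QuandleWord G → QuandleWord G → Prop) :
    QuandleWord G → QuandleWord G → Prop
  | of {a b} : r a b → Rel r a b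
  | refl (a) : Rel r a a
  | symm {a b} : Rel r a b → Rel r b a
  | trans {a b c} : Rel r a b → Rel r b c → Rel r a c
  | act_congr {a a' b b'} : Rel r a a' → Rel r b b' → Rel r (act a b) (act a' b')
  | invAct_congr {a a' b b'} : Rel r a a' → Rel r b b' → Rel r (invAct a b) (invAct a' b')
  | self_distrib (a b c) : Rel r (act a (act b c)) (act (act a b) (act a c))
  | left_inv (a b) : Rel r (invAct a (act a b)) b
  | right_inv (a b) : Rel r (act a (invAct a b)) b
  | fix (a) : Rel r (act a a) a

def QuandleWord.setoid {G : Type} (r : QuandleWord G → QuandleWord G → Prop) :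
    Setoid (QuandleWord G) where
  r := QuandleWord.Rel r
  iseqv := ⟨.refl, .symm, .trans⟩

/-- The quandle `Q⟨G | r⟩` with generators `G` and relations `r`. -/
def PresentedQuandle {G : Type} (r : QuandleWord G → QuandleWord G → Prop) : Type :=
  Quotient (QuandleWord.setoid r)

instance PresentedQuandle.instQuandle {G : Type} (r : QuandleWord G → QuandleWord G → Prop) :
    Quandle (PresentedQuandle r) where
  act := Quotient.map₂ QuandleWord.act fun _ _ h _ _ h' => .act_congr h h'
  self_distrib := by
    rintro ⟨a⟩ ⟨b⟩ ⟨c⟩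
    exact Quotient.sound (.self_distrib a b c)
  invAct := Quotient.map₂ QuandleWord.invAct fun _ _ h _ _ h' => .invAct_congr h h'
  left_inv := by
    rintro ⟨a⟩ ⟨b⟩
    exact Quotient.sound (.left_inv a b)
  right_inv := by
    rintro ⟨a⟩ ⟨b⟩
    exact Quotient.sound (.right_inv a b)
  fix := by
    rintro ⟨a⟩
    exact Quotient.sound (.fix a)

/-- The class of a generator. -/
def PresentedQuandle.of {G : Type} (r : QuandleWord G → QuandleWord G → Prop) (g : G) :
    PresentedQuandle r :=
  Quotient.mk (QuandleWord.setoid r) (.gen g)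

/- ### Linkoid diagrams

The source 1-manifold consists of `n` copies of `[0,1]` (components `Sum.inl i`) and `m` copies of
the circle `ℝ/ℤ` (components `Sum.inr k`). A point of it is given by a component and a real
parameter; parameters on a circle component are taken in `ℝ` and identified modulo `ℤ`. -/

/-- A component together with a real parameter. -/
abbrev LinkoidParam (n m : ℕ) : Type := (Fin n ⊕ Fin m) × ℝ

/-- The parameter denotes a point of the source: it lies in `[0,1]` on open components, and is
arbitrary on closed ones. -/
def LinkoidParam.Valid {n m : ℕ} (p : LinkoidParam n m) : Prop :=
  p.1.isLeft → p.2 ∈ Set.Icc (0 : ℝ) 1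

/-- The two parameters denote the same point of the source. -/
def LinkoidParam.Same {n m : ℕ} (p q : LinkoidParam n m) : Prop :=
  p.1 = q.1 ∧ (p.2 = q.2 ∨ (p.1.isRight ∧ ∃ z : ℤ, q.2 = p.2 + z))

/-- `p` and `q` are distinct points of the source with the same image in the plane. -/
def LinkoidParam.Crosses {n m : ℕ} (γ : Fin n ⊕ Fin m → ℝ → ℂ) (p q : LinkoidParam n m) : Prop :=
  p.Valid ∧ q.Valid ∧ ¬ p.Same q ∧ γ p.1 p.2 = γ q.1 q.2

/-- The determinant of the pair `(v, w)` of vectors of the oriented plane `ℂ = ℝ²`. -/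
def planeDet (v w : ℂ) : ℝ := v.re * w.im - v.im * w.re

/-- A diagram of an oriented, ordered linkoid with `n` open and `m` closed components: a generic
immersion into the plane of `n` intervals and `m` circles, whose finitely many double points
are transverse and carry over/under information. (Only the restriction of an open component's
curve to `[0,1]` matters.) -/
structure LinkoidDiagram (n m : ℕ) where
  curve : Fin n ⊕ Fin m → ℝ → ℂ
  smooth : ∀ c, ContDiff ℝ ∞ (curve c)
  periodic : ∀ k : Fin m, Function.Periodic (curve (Sum.inr k)) 1
  immersion : ∀ p : LinkoidParam n m, p.Valid → deriv (curve p.1) p.2 ≠ 0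
  transverse : ∀ p q : LinkoidParam n m, p.Crosses curve q →
    planeDet (deriv (curve p.1) p.2) (deriv (curve q.1) q.2) ≠ 0
  no_triple : ∀ p q r : LinkoidParam n m, p.Crosses curve q → p.Crosses curve r → q.Same r
  no_endpoint : ∀ p q : LinkoidParam n m, p.Crosses curve q → p.1.isLeft → p.2 ≠ 0 ∧ p.2 ≠ 1
  finite : {p : LinkoidParam n m | p.2 ∈ Set.Icc (0 : ℝ) 1 ∧ ∃ q, p.Crosses curve q}.Finite
  /-- The points of the source that pass under at a crossing. -/
  under : Set (LinkoidParam n m)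
  under_crosses : ∀ p ∈ under, ∃ q, p.Crosses curve q
  under_iff : ∀ p q : LinkoidParam n m, p.Crosses curve q → (p ∈ under ↔ q ∉ under)

namespace LinkoidDiagram

variable {n m : ℕ}

/-- The image of the immersion in the plane. -/
def trace (L : LinkoidDiagram n m) : Set ℂ :=
  {z | ∃ p : LinkoidParam n m, p.Valid ∧ L.curve p.1 p.2 = z}

/-- Points of the source that do not pass under; each of them lies on exactly one arc. -/
def ArcPoint (L : LinkoidDiagram n m) : Type :=
  {p : LinkoidParam n m // p.Valid ∧ p ∉ L.under}

/-- The defining relations of the fundamental quandle. An arc of the diagram is represented by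
any of its points. -/
inductive Relation (L : LinkoidDiagram n m) :
    QuandleWord L.ArcPoint → QuandleWord L.ArcPoint → Prop
  /-- Two parameters of the same point give the same generator. -/
  | same (p q : L.ArcPoint) (h : p.1.Same q.1) : Relation L (.gen p) (.gen q)
  /-- Two points with no underpass between them lie on the same arc. -/
  | arc (p q : L.ArcPoint) (hc : p.1.1 = q.1.1) (hle : p.1.2 ≤ q.1.2)
      (h : ∀ t ∈ Set.Icc p.1.2 q.1.2, (p.1.1, t) ∉ L.under) : Relation L (.gen p) (.gen q)
  /-- At a positive crossing, where `o` passes over `u`, and `a` and `c` lie on the arcs that come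
  into and go out of the underpass `u`, the relation is `c = a ▷ o`. -/
  | pos (u : LinkoidParam n m) (o a c : L.ArcPoint) (hu : u ∈ L.under)
      (ho : u.Crosses L.curve o.1)
      (ha : a.1.1 = u.1) (ha' : a.1.2 < u.2)
      (ha'' : ∀ t ∈ Set.Ico a.1.2 u.2, (u.1, t) ∉ L.under)
      (hc : c.1.1 = u.1) (hc' : u.2 < c.1.2)
      (hc'' : ∀ t ∈ Set.Ioc u.2 c.1.2, (u.1, t) ∉ L.under)
      (hpos : 0 < planeDet (deriv (L.curve o.1.1) o.1.2) (deriv (L.curve u.1) u.2)) :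
      Relation L (.gen c) (.act (.gen o) (.gen a))
  /-- At a negative crossing the relation is `a = c ▷ o`. -/
  | neg (u : LinkoidParam n m) (o a c : L.ArcPoint) (hu : u ∈ L.under)
      (ho : u.Crosses L.curve o.1)
      (ha : a.1.1 = u.1) (ha' : a.1.2 < u.2)
      (ha'' : ∀ t ∈ Set.Ico a.1.2 u.2, (u.1, t) ∉ L.under)
      (hc : c.1.1 = u.1) (hc' : u.2 < c.1.2)
      (hc'' : ∀ t ∈ Set.Ioc u.2 c.1.2, (u.1, t) ∉ L.under)
      (hneg : planeDet (deriv (L.curve o.1.1) o.1.2) (deriv (L.curve u.1) u.2) < 0) :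
      Relation L (.gen a) (.act (.gen o) (.gen c))

/-- The fundamental quandle `Q(L)`. -/
abbrev Q (L : LinkoidDiagram n m) : Type := PresentedQuandle L.Relation

/-- The generator of `Q(L)` given by the arc through a point. -/
def arcGen (L : LinkoidDiagram n m) (p : L.ArcPoint) : L.Q := PresentedQuandle.of L.Relation p

/-- The initial point of the `i`-th open component. -/
def legPoint (L : LinkoidDiagram n m) (i : Fin n) : L.ArcPoint :=
  ⟨(Sum.inl i, 0), fun _ => by simp, fun h => by
    obtain ⟨q, hq⟩ := L.under_crosses _ h
    exact (L.no_endpoint _ q hq rfl).1 rfl⟩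

/-- The terminal point of the `i`-th open component. -/
def headPoint (L : LinkoidDiagram n m) (i : Fin n) : L.ArcPoint :=
  ⟨(Sum.inl i, 1), fun _ => by simp, fun h => by
    obtain ⟨q, hq⟩ := L.under_crosses _ h
    exact (L.no_endpoint _ q hq rfl).2 rfl⟩

/-- The generator `l_i` of the arc adjacent to the leg of the `i`-th open component. -/
def leg (L : LinkoidDiagram n m) (i : Fin n) : L.Q := L.arcGen (L.legPoint i)

/-- The generator `h_i` of the arc adjacent to the head of the `i`-th open component. -/
def head (L : LinkoidDiagram n m) (i : Fin n) : L.Q := L.arcGen (L.headPoint i)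

/-- The fundamental pointed quandle `P(L) = (Q(L), l_1, h_1, …, l_n, h_n)`. -/
def P (L : LinkoidDiagram n m) : PointedQuandle (2 * n) where
  carrier := L.Q
  base j :=
    if j.1 % 2 = 0 then L.leg ⟨j.1 / 2, by omega⟩ else L.head ⟨j.1 / 2, by omega⟩

/-- A 1-linkoid diagram is of link-type if its leg and its head lie in (the closure of) the same
region, that is, the same connected component of the complement of the diagram. -/
def IsLinkType (L : LinkoidDiagram 1 m) : Prop :=
  ∃ x ∈ L.traceᶜ,
    L.curve (Sum.inl 0) 0 ∈ closure (connectedComponentIn L.traceᶜ x) ∧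
    L.curve (Sum.inl 0) 1 ∈ closure (connectedComponentIn L.traceᶜ x)

/-- How the source of a 1-linkoid diagram sits in the source of its closure: the open component
is the first half of the closed component `0`, and the `k`-th closed component becomes the
closed component `k + 1`. -/
def closureParam (p : LinkoidParam 1 m) : LinkoidParam 0 (m + 1) :=
  match p with
  | (Sum.inl _, t) => (Sum.inr 0, t / 2)
  | (Sum.inr k, t) => (Sum.inr k.succ, t)

/-- The link diagram `C` is an under-closure of the 1-linkoid diagram `L`: it is `L` together with
an arc from the head to the leg (the second half of the component `0` of `C`) that meets the
rest of the diagram only in transverse crossings, away from the endpoints of `L`, and passes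
under at each of them. (Since only one of the two strands of a crossing passes under, the arc
does not cross itself.) -/
structure IsUnderClosure (L : LinkoidDiagram 1 m) (C : LinkoidDiagram 0 (m + 1)) : Prop where
  curve_eq : ∀ p : LinkoidParam 1 m, p.Valid →
    C.curve (closureParam p).1 (closureParam p).2 = L.curve p.1 p.2
  under_iff : ∀ p : LinkoidParam 1 m, p.Valid → (closureParam p ∈ C.under ↔ p ∈ L.under)
  leg_not_crossing : ∀ q, ¬ LinkoidParam.Crosses C.curve (Sum.inr 0, 0) q
  head_not_crossing : ∀ q, ¬ LinkoidParam.Crosses C.curve (Sum.inr 0, 1 / 2) q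
  arc_under : ∀ t ∈ Set.Ioo (1 / 2 : ℝ) 1, ∀ q,
    LinkoidParam.Crosses C.curve (Sum.inr 0, t) q → ((Sum.inr 0, t) : LinkoidParam _ _) ∈ C.under

/-- The closure of a link-type diagram: the endpoints are joined by an arc inside a region,
so that no crossing is created. -/
structure IsLinkTypeClosure (L : LinkoidDiagram 1 m) (C : LinkoidDiagram 0 (m + 1)) : Prop
    extends IsUnderClosure L C where
  arc_disjoint : ∀ t ∈ Set.Ioo (1 / 2 : ℝ) 1, C.curve (Sum.inr 0) t ∉ L.trace

/-- The sequence of forbidden under moves by which the head of `L` travels along the closing arc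
of the under-closure `C` into the region of the leg: in the `i`-th move, at the parameter `time i`
of the closing arc, the head slides under the strand of `L` through the point `overPoint i`. -/
structure UnderMoves (L : LinkoidDiagram 1 m) (C : LinkoidDiagram 0 (m + 1)) where
  num : ℕ
  time : Fin num → ℝ
  time_strictMono : StrictMono time
  range_time : Set.range time =
    {t | t ∈ Set.Ioo (1 / 2 : ℝ) 1 ∧ ((Sum.inr 0, t) : LinkoidParam 0 (m + 1)) ∈ C.under}
  overPoint : Fin num → L.ArcPoint
  crosses : ∀ i, LinkoidParam.Crosses C.curve (Sum.inr 0, time i) (closureParam (overPoint i).1)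

namespace UnderMoves

variable {L : LinkoidDiagram 1 m} {C : LinkoidDiagram 0 (m + 1)}

open Classical in
/-- The effect of the `i`-th move on the label of the head: `β_b` if the head slides under the
arc `b` from right to left, and `β_b⁻¹` if from left to right. -/
def step (s : UnderMoves L C) (i : Fin s.num) : QuandleInn L.Q :=
  if 0 < planeDet
      (deriv (C.curve (closureParam (s.overPoint i).1).1) (closureParam (s.overPoint i).1).2)
      (deriv (C.curve (Sum.inr 0)) (s.time i)) then
    quandleBeta (L.arcGen (s.overPoint i))
  else (quandleBeta (L.arcGen (s.overPoint i)))⁻¹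

/-- The inner automorphism `f` of `Q(L)` derived from the sequence of moves: the composite of the
steps, the first move being applied first. The closing relation is `f(h) = l`. -/
def closingMap (s : UnderMoves L C) : QuandleInn L.Q :=
  (List.ofFn s.step).reverse.prod

/-- The pointed quandle `(Q(L), l, f(h))`. -/
def pointedQuandle (s : UnderMoves L C) : PointedQuandle 2 where
  carrier := L.Q
  base := ![L.leg 0, (s.closingMap : Equiv.Perm L.Q) (L.head 0)]

end UnderMoves

end LinkoidDiagram

end

open scoped Quandles

noncomputable section

/- ### Homomorphisms from presented quandles -/

/-! The whole theorem rests on one fact: the quandle of an under-closure `C` is the quotient of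
`Q(L)` by the single relation `f(h) = l`. Since the closing arc always passes under, every
over-strand of `C` comes from `L`. So the arcs and crossing relations of `L` survive in `C`, giving
a homomorphism `closureHom` from `Q(L)` to `Q(C)`. Along the closing arc each crossing expresses the
next label through the previous one. The label of the arc at time `t` is therefore the image of `h`
under the moves made so far (`arcGen_closing`), and arrival at the leg forces `f(h) = l`
(`closureHom_closing`). No generator of `Q(C)` lies outside the image (`exists_closureHom_eq`).

Conversely, let `g` be a homomorphism from `Q(L)` with `g(f(h)) = g(l)`. Colour the closing arc by
the values of `g` on the running label of the head. The closing relation is exactly what makes this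
colouring agree at the leg, so it is a colouring of `C`, and `g` factors through `closureHom`
(`exists_extension`).

An isomorphism matching the basepoints `l` and `f(h)` carries one closing relation to the other, so
the two quotients are isomorphic by their universal property. A link-type closure makes no moves, so
there `f` is the identity and part (1) is a case of part (2). -/

theorem ShelfHom.map_invAct {X Y : Type} [Rack X] [Rack Y] (g : X →◃ Y) (a b : X) :
    g (a ◃⁻¹ b) = g a ◃⁻¹ g b := by
  rw [← Rack.left_cancel (g a), ← g.map_act, Rack.act_invAct_eq, Rack.act_invAct_eq]

/-- The value of a word under an assignment of elements of a quandle to the letters. -/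
def QuandleWord.eval {G X : Type} [Quandle X] (f : G → X) : QuandleWord G → X
  | gen g => f g
  | act a b => a.eval f ◃ b.eval f
  | invAct a b => a.eval f ◃⁻¹ b.eval f

theorem QuandleWord.Rel.eval_eq {G X : Type} [Quandle X] {f : G → X}
    {r : QuandleWord G → QuandleWord G → Prop} (hr : ∀ a b, r a b → a.eval f = b.eval f)
    {a b : QuandleWord G} (h : QuandleWord.Rel r a b) : a.eval f = b.eval f := by
  induction h with
  | of h => exact hr _ _ h
  | refl => rfl
  | symm _ ih => exact ih.symm
  | trans _ _ ih₁ ih₂ => exact ih₁.trans ih₂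
  | act_congr _ _ ih₁ ih₂ => simp only [eval, ih₁, ih₂]
  | invAct_congr _ _ ih₁ ih₂ => simp only [eval, ih₁, ih₂]
  | self_distrib => exact Shelf.self_distrib
  | left_inv => exact Rack.invAct_act_eq _ _
  | right_inv => exact Rack.act_invAct_eq _ _
  | fix => exact Quandle.fix

namespace PresentedQuandle

variable {G X : Type} [Quandle X] {r : QuandleWord G → QuandleWord G → Prop}

/-- The homomorphism from a presented quandle given by an assignment that respects the relations. -/
def lift (f : G → X) (hr : ∀ a b, r a b → a.eval f = b.eval f) : PresentedQuandle r →◃ X where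
  toFun := Quotient.lift (QuandleWord.eval f) fun _ _ h => QuandleWord.Rel.eval_eq hr h
  map_act' := by
    rintro ⟨a⟩ ⟨b⟩
    rfl

theorem of_eq {a b : G} (h : r (.gen a) (.gen b)) : of r a = of r b :=
  Quotient.sound (.of h)

theorem of_eq_act {a b c : G} (h : r (.gen c) (.act (.gen b) (.gen a))) :
    of r c = of r b ◃ of r a :=
  Quotient.sound (.of h)

theorem hom_ext {g₁ g₂ : PresentedQuandle r →◃ X} (h : ∀ a, g₁ (of r a) = g₂ (of r a)) (x) :
    g₁ x = g₂ x := by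
  obtain ⟨w⟩ := x
  induction w with
  | gen a => exact h a
  | act a b iha ihb =>
    exact g₁.map_act.trans ((congrArg₂ Shelf.act iha ihb).trans g₂.map_act.symm)
  | invAct a b iha ihb =>
    exact (g₁.map_invAct _ _).trans
      ((congrArg₂ Rack.invAct iha ihb).trans (g₂.map_invAct _ _).symm)

end PresentedQuandle

open Classical in
/-- The action of `o` for positive `d`, and its inverse otherwise. -/
def signedAct {X : Type} [Quandle X] (d : ℝ) (o a : X) : X := if 0 < d then o ◃ a else o ◃⁻¹ a

theorem ShelfHom.map_signedAct {X Y : Type} [Quandle X] [Quandle Y] (g : X →◃ Y) (d : ℝ)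
    (o a : X) : g (signedAct d o a) = signedAct d (g o) (g a) := by
  unfold signedAct
  split_ifs
  · exact g.map_act
  · exact g.map_invAct _ _

/- ### Points of a diagram -/

theorem LinkoidParam.Same.refl {n m : ℕ} (p : LinkoidParam n m) : p.Same p := ⟨rfl, .inl rfl⟩

theorem LinkoidParam.Same.symm {n m : ℕ} {p q : LinkoidParam n m} (h : p.Same q) : q.Same p := by
  obtain ⟨h₁, h₂ | ⟨h₂, z, hz⟩⟩ := h
  · exact ⟨h₁.symm, .inl h₂.symm⟩
  · exact ⟨h₁.symm, .inr ⟨h₁ ▸ h₂, -z, by simp [hz]⟩⟩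

theorem LinkoidParam.Same.trans {n m : ℕ} {p q r : LinkoidParam n m} (h : p.Same q)
    (h' : q.Same r) : p.Same r := by
  obtain ⟨h₁, h₂ | ⟨h₂, z, hz⟩⟩ := h
  · exact ⟨h₁.trans h'.1, by rw [h₁, h₂]; exact h'.2⟩
  · obtain ⟨h₁', h₂' | ⟨h₂', z', hz'⟩⟩ := h'
    · exact ⟨h₁.trans h₁', .inr ⟨h₂, z, by rw [← h₂', hz]⟩⟩
    · exact ⟨h₁.trans h₁', .inr ⟨h₂, z + z', by rw [hz', hz]; push_cast; ring⟩⟩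

theorem LinkoidParam.Crosses.symm {n m : ℕ} {γ : Fin n ⊕ Fin m → ℝ → ℂ} {p q : LinkoidParam n m}
    (h : p.Crosses γ q) : q.Crosses γ p :=
  ⟨h.2.1, h.1, fun h' => h.2.2.1 h'.symm, h.2.2.2.symm⟩

theorem LinkoidParam.Same.valid {n m : ℕ} {p q : LinkoidParam n m} (h : p.Same q)
    (hp : p.Valid) : q.Valid := by
  intro hq
  obtain ⟨h₁, h₂ | ⟨h₂, -⟩⟩ := h
  · rw [← h₂]
    exact hp (h₁ ▸ hq)
  · rw [h₁] at h₂
    cases hc : q.1 <;> simp_all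

namespace LinkoidDiagram

variable {n m : ℕ} (D : LinkoidDiagram n m)

theorem curve_same {p q : LinkoidParam n m} (h : p.Same q) :
    D.curve p.1 p.2 = D.curve q.1 q.2 ∧ deriv (D.curve p.1) p.2 = deriv (D.curve q.1) q.2 := by
  obtain ⟨c, t⟩ := p
  obtain ⟨c', t'⟩ := q
  obtain ⟨h₁, h₂⟩ := h
  dsimp only at h₁ h₂ ⊢
  subst h₁
  obtain rfl | ⟨hr, z, rfl⟩ := h₂
  · exact ⟨rfl, rfl⟩
  · obtain c | c := c
    · simp at hr
    · have hp : Function.Periodic (D.curve (Sum.inr c)) z := by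
        simpa using (D.periodic c).int_mul z
      refine ⟨(hp t).symm, ?_⟩
      rw [← deriv_comp_add_const]
      exact congrArg (fun f => deriv f t) (funext fun x => (hp x).symm)

variable {D}

theorem crosses_same_left {p p' q : LinkoidParam n m} (h : p.Same p') (hc : p.Crosses D.curve q) :
    p'.Crosses D.curve q :=
  ⟨h.valid hc.1, hc.2.1, fun h' => hc.2.2.1 (h.trans h'),
    (D.curve_same h).1.symm.trans hc.2.2.2⟩

theorem crosses_same_right {p q q' : LinkoidParam n m} (h : q.Same q')
    (hc : p.Crosses D.curve q) : p.Crosses D.curve q' :=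
  (crosses_same_left h hc.symm).symm

/-- The set `under` consists of parameters and is not assumed periodic. Periodicity follows because
both parameters cross the same third point, and exactly one strand passes under there. -/
theorem under_same {p q : LinkoidParam n m} (h : p.Same q) (hp : p ∈ D.under) : q ∈ D.under := by
  obtain ⟨r, hr⟩ := D.under_crosses p hp
  exact (D.under_iff q r (crosses_same_left h hr)).2 ((D.under_iff p r hr).1 hp)

theorem under_same_iff {p q : LinkoidParam n m} (h : p.Same q) : p ∈ D.under ↔ q ∈ D.under :=
  ⟨under_same h, under_same h.symm⟩

/-- The sign of the crossing at which `o` passes over `u`. -/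
def crossingDet (D : LinkoidDiagram n m) (o u : LinkoidParam n m) : ℝ :=
  planeDet (deriv (D.curve o.1) o.2) (deriv (D.curve u.1) u.2)

theorem crossingDet_same {o o' u u' : LinkoidParam n m} (ho : o.Same o') (hu : u.Same u') :
    D.crossingDet o u = D.crossingDet o' u' := by
  unfold crossingDet
  rw [(D.curve_same ho).2, (D.curve_same hu).2]

/-- The points `a` and `c` lie just before and just after the underpass `u`. -/
structure Flanks (D : LinkoidDiagram n m) (u : LinkoidParam n m) (a c : D.ArcPoint) : Prop where
  mem_under : u ∈ D.under
  fst_left : a.1.1 = u.1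
  left_lt : a.1.2 < u.2
  left_free : ∀ t ∈ Set.Ico a.1.2 u.2, (u.1, t) ∉ D.under
  fst_right : c.1.1 = u.1
  lt_right : u.2 < c.1.2
  right_free : ∀ t ∈ Set.Ioc u.2 c.1.2, (u.1, t) ∉ D.under

/-! ### Colourings by a quandle, and homomorphisms from the fundamental quandle -/

variable {X : Type} [Quandle X]

/-- A colouring of the arcs of a diagram by a quandle. -/
structure IsColoring (D : LinkoidDiagram n m) (f : D.ArcPoint → X) : Prop where
  same : ∀ p q : D.ArcPoint, p.1.Same q.1 → f p = f q
  arc : ∀ p q : D.ArcPoint, p.1.1 = q.1.1 → p.1.2 ≤ q.1.2 →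
    (∀ t ∈ Set.Icc p.1.2 q.1.2, (p.1.1, t) ∉ D.under) → f p = f q
  crossing : ∀ (u : LinkoidParam n m) (o a c : D.ArcPoint), u.Crosses D.curve o.1 →
    D.Flanks u a c → f c = signedAct (D.crossingDet o.1 u) (f o) (f a)

theorem isColoring_arcGen (D : LinkoidDiagram n m) : D.IsColoring D.arcGen where
  same p q h := PresentedQuandle.of_eq (.same p q h)
  arc p q h₁ h₂ h₃ := PresentedQuandle.of_eq (.arc p q h₁ h₂ h₃)
  crossing u o a c ho h := by
    obtain ⟨hu, h₁, h₂, h₃, h₄, h₅, h₆⟩ := h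
    unfold signedAct
    split_ifs with hd
    · exact PresentedQuandle.of_eq_act (.pos u o a c hu ho h₁ h₂ h₃ h₄ h₅ h₆ hd)
    · have hd' : D.crossingDet o.1 u < 0 :=
        lt_of_le_of_ne (not_lt.1 hd) (D.transverse _ _ ho.symm)
      have : D.arcGen a = D.arcGen o ◃ D.arcGen c :=
        PresentedQuandle.of_eq_act (.neg u o a c hu ho h₁ h₂ h₃ h₄ h₅ h₆ hd')
      rw [this, Rack.invAct_act_eq]

theorem IsColoring.eval_eq {f : D.ArcPoint → X} (hf : D.IsColoring f)
    (a b : QuandleWord D.ArcPoint) (h : D.Relation a b) : a.eval f = b.eval f := by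
  cases h with
  | same p q h => exact hf.same p q h
  | arc p q h₁ h₂ h₃ => exact hf.arc p q h₁ h₂ h₃
  | pos u o a c hu ho h₁ h₂ h₃ h₄ h₅ h₆ hd =>
    have := hf.crossing u o a c ho ⟨hu, h₁, h₂, h₃, h₄, h₅, h₆⟩
    rwa [signedAct, if_pos (show 0 < D.crossingDet o.1 u from hd)] at this
  | neg u o a c hu ho h₁ h₂ h₃ h₄ h₅ h₆ hd =>
    have := hf.crossing u o a c ho ⟨hu, h₁, h₂, h₃, h₄, h₅, h₆⟩
    rw [signedAct, if_neg (not_lt.2 (show D.crossingDet o.1 u ≤ 0 from hd.le))] at this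
    simp only [QuandleWord.eval]
    rw [this, Rack.act_invAct_eq]

/-- The homomorphism from the fundamental quandle given by a colouring. -/
def IsColoring.lift {f : D.ArcPoint → X} (hf : D.IsColoring f) : D.Q →◃ X :=
  PresentedQuandle.lift f hf.eval_eq

theorem Q_hom_ext {g₁ g₂ : D.Q →◃ X} (h : ∀ p, g₁ (D.arcGen p) = g₂ (D.arcGen p)) (x) :
    g₁ x = g₂ x :=
  PresentedQuandle.hom_ext h x

/-- For a link diagram the crossing relations need to be checked only close to the crossings. -/
theorem IsColoring.of_near {D : LinkoidDiagram 0 m} {f : D.ArcPoint → X}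
    (same : ∀ p q : D.ArcPoint, p.1.Same q.1 → f p = f q)
    (arc : ∀ p q : D.ArcPoint, p.1.1 = q.1.1 → p.1.2 ≤ q.1.2 →
      (∀ t ∈ Set.Icc p.1.2 q.1.2, (p.1.1, t) ∉ D.under) → f p = f q)
    (near : ∀ (u : LinkoidParam 0 m) (o : D.ArcPoint), u.Crosses D.curve o.1 → u ∈ D.under →
      ∃ ε > 0, ∀ a c : D.ArcPoint, D.Flanks u a c → u.2 - ε < a.1.2 → c.1.2 < u.2 + ε →
        f c = signedAct (D.crossingDet o.1 u) (f o) (f a)) : D.IsColoring f where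
  same := same
  arc := arc
  crossing u o a c ho h := by
    obtain ⟨ε, hε, H⟩ := near u o ho h.mem_under
    obtain ⟨⟨a₁, a₂⟩, ha⟩ := a
    obtain ⟨⟨c₁, c₂⟩, hc⟩ := c
    obtain ⟨u₁, u₂⟩ := u
    obtain ⟨hu, h₁, h₂, h₃, h₄, h₅, h₆⟩ := h
    dsimp only at h₁ h₂ h₃ h₄ h₅ h₆ H
    subst h₁
    subst h₄
    have valid : ∀ p : LinkoidParam 0 m, p.Valid := by
      rintro ⟨i | i, t⟩ h
      · exact i.elim0
      · simp at h
    -- Both points are moved along their arcs towards the underpass: `ε / 2` gives the strict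
    -- bounds, while `max` and `min` prevent leaving the given arcs.
    have hA : max a₂ (u₂ - ε / 2) ∈ Set.Ico a₂ u₂ := ⟨le_max_left _ _, max_lt h₂ (by linarith)⟩
    have hC : min c₂ (u₂ + ε / 2) ∈ Set.Ioc u₂ c₂ := ⟨lt_min h₅ (by linarith), min_le_left _ _⟩
    have e₁ := arc ⟨(c₁, a₂), ha⟩ ⟨(c₁, _), valid _, h₃ _ hA⟩ rfl hA.1
      fun t ht => h₃ t ⟨ht.1, ht.2.trans_lt hA.2⟩
    have e₂ := arc ⟨(c₁, _), valid _, h₆ _ hC⟩ ⟨(c₁, c₂), hc⟩ rfl hC.2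
      fun t ht => h₆ t ⟨hC.1.trans_le ht.1, ht.2⟩
    rw [e₁, ← e₂]
    refine H _ _ ⟨hu, rfl, hA.2, fun t ht => h₃ t ⟨hA.1.trans ht.1, ht.2⟩, rfl, hC.1,
      fun t ht => h₆ t ⟨ht.1, ht.2.trans hC.2⟩⟩ ?_ ?_
    · exact (by linarith : u₂ - ε < u₂ - ε / 2).trans_le (le_max_right _ _)
    · exact (min_le_right _ _).trans_lt (by linarith)

end LinkoidDiagram

theorem signedAct_mul {X : Type} [Quandle X] {r : ℝ} (hr : 0 < r) (d : ℝ) (o a : X) :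
    signedAct (r * d) o a = signedAct d o a := by
  simp only [signedAct, mul_pos_iff_of_pos_left hr]

theorem LinkoidParam.valid_of_closed {m : ℕ} (p : LinkoidParam 0 m) : p.Valid := by
  obtain ⟨i | i, t⟩ := p
  · exact i.elim0
  · intro h
    simp at h

namespace LinkoidDiagram

variable {m : ℕ} {L : LinkoidDiagram 1 m} {C : LinkoidDiagram 0 (m + 1)}

/- ### The diagram inside its closure -/

theorem closureParam_same {p q : LinkoidParam 1 m} (h : p.Same q) :
    (closureParam p).Same (closureParam q) := by
  obtain ⟨i | k, t⟩ := p <;> obtain ⟨j | k', t'⟩ := q <;> obtain ⟨h₁, h₂⟩ := h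
  · obtain rfl : t = t' := by simpa using h₂
    exact .refl _
  · simp at h₁
  · simp at h₁
  · obtain rfl : k = k' := by simpa using h₁
    exact ⟨rfl, h₂⟩

theorem same_of_closureParam_same {p q : LinkoidParam 1 m} (hp : p.Valid) (hq : q.Valid)
    (h : (closureParam p).Same (closureParam q)) : p.Same q := by
  obtain ⟨i | k, t⟩ := p <;> obtain ⟨j | k', t'⟩ := q <;> obtain ⟨h₁, h₂⟩ := h
  · obtain rfl : i = j := Subsingleton.elim _ _
    have ht := hp rfl
    have ht' := hq rfl
    dsimp only [closureParam] at h₂ ht ht'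
    refine ⟨rfl, .inl ?_⟩
    obtain h₂ | ⟨-, z, hz⟩ := h₂
    · dsimp only; linarith
    · obtain ⟨h0, h1⟩ := ht
      obtain ⟨h0', h1'⟩ := ht'
      -- Both halved parameters lie in `[0, 1/2]`, so the integer by which they differ must vanish.
      have hz₁ : (z : ℝ) < 1 := by linarith
      have hz₂ : (-1 : ℝ) < z := by linarith
      have : z = 0 := by
        have := Int.cast_lt.1 (hz₁.trans_eq Int.cast_one.symm)
        have : -1 < z := by exact_mod_cast hz₂
        omega
      subst this
      dsimp only
      simp only [Int.cast_zero, add_zero] at hz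
      linarith
  · simp [closureParam, Fin.ext_iff] at h₁
  · simp [closureParam, Fin.ext_iff] at h₁
  · obtain rfl : k = k' := by simpa [closureParam] using h₁
    exact ⟨rfl, h₂⟩

/-- A point of the closure lies on the closing arc or on the original diagram. -/
theorem closing_or_closureParam (p : LinkoidParam 0 (m + 1)) :
    (∃ t ∈ Set.Ioo (1 / 2 : ℝ) 1, p.Same (Sum.inr 0, t)) ∨
      ∃ q : LinkoidParam 1 m, q.Valid ∧ p.Same (closureParam q) := by
  obtain ⟨i | c, t⟩ := p
  · exact i.elim0
  induction c using Fin.cases with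
  | zero =>
    have hs : LinkoidParam.Same ((Sum.inr 0, t) : LinkoidParam 0 (m + 1)) (Sum.inr 0, Int.fract t) :=
      ⟨rfl, .inr ⟨rfl, -⌊t⌋, by simp [Int.fract, sub_eq_add_neg]⟩⟩
    have h₀ := Int.fract_nonneg t
    have h₁ := Int.fract_lt_one t
    by_cases h : Int.fract t ≤ 1 / 2
    · refine .inr ⟨(Sum.inl 0, 2 * Int.fract t), fun _ => ⟨?_, ?_⟩, ?_⟩
      · dsimp only; linarith
      · dsimp only; linarith
      · simpa [closureParam] using hs
    · exact .inl ⟨_, ⟨not_le.1 h, h₁⟩, hs⟩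
  | succ k => exact .inr ⟨(Sum.inr k, t), fun h => by simp at h, .refl _⟩

namespace IsUnderClosure

variable (hC : L.IsUnderClosure C)
include hC

theorem crosses_iff {p q : LinkoidParam 1 m} (hp : p.Valid) (hq : q.Valid) :
    (closureParam p).Crosses C.curve (closureParam q) ↔ p.Crosses L.curve q := by
  constructor
  · rintro ⟨-, -, h, e⟩
    rw [hC.curve_eq p hp, hC.curve_eq q hq] at e
    exact ⟨hp, hq, fun h' => h (closureParam_same h'), e⟩
  · rintro ⟨-, -, h, e⟩
    rw [← hC.curve_eq p hp, ← hC.curve_eq q hq] at e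
    exact ⟨LinkoidParam.valid_of_closed _, LinkoidParam.valid_of_closed _,
      fun h' => h (same_of_closureParam_same hp hq h'), e⟩

/-- The open component is traversed at half the parameter, which scales its velocity by `1/2`;
closed components are unchanged. The crossing hypothesis keeps the point off the endpoints, beyond
which the two curves need not agree. -/
theorem deriv_curve {p q : LinkoidParam 1 m} (h : p.Crosses L.curve q) :
    ∃ r : ℝ, 0 < r ∧ deriv (L.curve p.1) p.2 =
      r • deriv (C.curve (closureParam p).1) (closureParam p).2 := by
  have hend := L.no_endpoint p q h
  have hv := h.1
  obtain ⟨i | k, t⟩ := p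
  · obtain rfl : i = 0 := Subsingleton.elim _ _
    have ht := hv rfl
    have hne := hend rfl
    dsimp only [closureParam] at ht hne ⊢
    refine ⟨1 / 2, by norm_num, ?_⟩
    have ht' : t ∈ Set.Ioo (0 : ℝ) 1 := ⟨lt_of_le_of_ne ht.1 hne.1.symm, lt_of_le_of_ne ht.2 hne.2⟩
    have e : L.curve (Sum.inl 0) =ᶠ[nhds t] fun x => C.curve (Sum.inr 0) (x / 2) := by
      filter_upwards [Ioo_mem_nhds ht'.1 ht'.2] with x hx
      exact (hC.curve_eq (Sum.inl 0, x) fun _ => ⟨hx.1.le, hx.2.le⟩).symm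
    rw [e.deriv_eq]
    have hd : HasDerivAt (C.curve (Sum.inr 0)) (deriv (C.curve (Sum.inr 0)) (t / 2)) (t / 2) :=
      ((C.smooth _).differentiable (by simp) _).hasDerivAt
    exact (hd.scomp t ((hasDerivAt_id t).div_const 2)).deriv
  · refine ⟨1, one_pos, ?_⟩
    rw [one_smul]
    have : L.curve (Sum.inr k) = C.curve (Sum.inr k.succ) :=
      funext fun x => (hC.curve_eq (Sum.inr k, x) fun h => by simp at h).symm
    dsimp only [closureParam]
    rw [this]

/-- Crossing signs agree in the diagram and in its closure, and `signedAct` sees only the sign. -/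
theorem crossingDet_eq {o u : LinkoidParam 1 m} (h : u.Crosses L.curve o) :
    ∃ r : ℝ, 0 < r ∧
      L.crossingDet o u = r * C.crossingDet (closureParam o) (closureParam u) := by
  obtain ⟨r, hr, er⟩ := hC.deriv_curve h
  obtain ⟨r', hr', er'⟩ := hC.deriv_curve h.symm
  refine ⟨r' * r, mul_pos hr' hr, ?_⟩
  unfold crossingDet planeDet
  rw [er, er']
  simp only [Complex.smul_re, Complex.smul_im, smul_eq_mul]
  ring

/-- A point of the diagram as a point of its closure. -/
def closurePoint (p : L.ArcPoint) : C.ArcPoint :=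
  ⟨closureParam p.1, LinkoidParam.valid_of_closed _,
    fun h => p.2.2 ((hC.under_iff p.1 p.2.1).1 h)⟩

theorem isColoring_closurePoint :
    L.IsColoring fun p => C.arcGen (hC.closurePoint p) where
  same p q h := C.isColoring_arcGen.same _ _ (closureParam_same h)
  arc p q h₁ h₂ h₃ := by
    obtain ⟨⟨c, t⟩, hp⟩ := p
    obtain ⟨⟨c', t'⟩, hq⟩ := q
    dsimp only at h₁ h₂ h₃
    subst h₁
    obtain i | k := c
    · obtain rfl : i = 0 := Subsingleton.elim _ _
      refine C.isColoring_arcGen.arc _ _ rfl (div_le_div_of_nonneg_right h₂ zero_le_two) ?_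
      intro x hx hu
      dsimp only [closurePoint, closureParam] at hx hu
      have hx' : 2 * x ∈ Set.Icc t t' := ⟨by linarith [hx.1], by linarith [hx.2]⟩
      refine h₃ _ hx' ((hC.under_iff (Sum.inl 0, 2 * x) fun _ =>
        ⟨(hp.1 rfl).1.trans hx'.1, hx'.2.trans (hq.1 rfl).2⟩).1 ?_)
      simpa [closureParam] using hu
    · exact C.isColoring_arcGen.arc _ _ rfl h₂ fun x hx hu =>
        h₃ x hx ((hC.under_iff (Sum.inr k, x) fun h => by simp at h).1 hu)
  crossing u o a c ho h := by
    obtain ⟨r, hr, er⟩ := hC.crossingDet_eq ho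
    rw [er, signedAct_mul hr]
    refine C.isColoring_arcGen.crossing _ (hC.closurePoint o) _ _
      ((hC.crosses_iff ho.1 ho.2.1).2 ho) ?_
    obtain ⟨⟨a₁, a₂⟩, ha⟩ := a
    obtain ⟨⟨c₁, c₂⟩, hc⟩ := c
    obtain ⟨u₁, u₂⟩ := u
    obtain ⟨hu, h₁, h₂, h₃, h₄, h₅, h₆⟩ := h
    dsimp only at h₁ h₂ h₃ h₄ h₅ h₆
    subst h₁
    subst h₄
    refine ⟨(hC.under_iff _ ho.1).2 hu, ?_, ?_, ?_, ?_, ?_, ?_⟩ <;> obtain i | k := c₁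
    · rfl
    · rfl
    · exact div_lt_div_of_pos_right h₂ two_pos
    · exact h₂
    · obtain rfl : i = 0 := Subsingleton.elim _ _
      intro x hx hxu
      dsimp only [closurePoint, closureParam] at hx hxu
      have hx' : 2 * x ∈ Set.Ico a₂ u₂ := ⟨by linarith [hx.1], by linarith [hx.2]⟩
      refine h₃ _ hx' ((hC.under_iff (Sum.inl 0, 2 * x) fun _ =>
        ⟨(ha.1 rfl).1.trans hx'.1, hx'.2.le.trans (ho.1 rfl).2⟩).1 ?_)
      simpa [closureParam] using hxu
    · exact fun x hx hxu => h₃ x hx ((hC.under_iff (Sum.inr k, x) fun h => by simp at h).1 hxu)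
    · rfl
    · rfl
    · exact div_lt_div_of_pos_right h₅ two_pos
    · exact h₅
    · obtain rfl : i = 0 := Subsingleton.elim _ _
      intro x hx hxu
      dsimp only [closurePoint, closureParam] at hx hxu
      have hx' : 2 * x ∈ Set.Ioc u₂ c₂ := ⟨by linarith [hx.1], by linarith [hx.2]⟩
      refine h₆ _ hx' ((hC.under_iff (Sum.inl 0, 2 * x) fun _ =>
        ⟨(ho.1 rfl).1.trans hx'.1.le, hx'.2.trans (hc.1 rfl).2⟩).1 ?_)
      simpa [closureParam] using hxu
    · exact fun x hx hxu => h₆ x hx ((hC.under_iff (Sum.inr k, x) fun h => by simp at h).1 hxu)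

/-- The homomorphism `Q(L) → Q(C)` induced by the inclusion of a diagram into its closure. -/
def closureHom : L.Q →◃ C.Q := hC.isColoring_closurePoint.lift

/-- The closing arc passes under at each of its crossings, so it is never the over-strand. -/
theorem exists_over {u : LinkoidParam 0 (m + 1)} {o : C.ArcPoint} (h : u.Crosses C.curve o.1) :
    ∃ o' : L.ArcPoint, o.1.Same (closureParam o'.1) := by
  obtain ⟨t, ht, hs⟩ | ⟨q, hq, hs⟩ := closing_or_closureParam o.1
  · have := hC.arc_under t ht u (crosses_same_left hs h.symm)
    exact absurd (under_same hs.symm this) o.2.2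
  · exact ⟨⟨q, hq, fun hu => o.2.2 (under_same hs.symm ((hC.under_iff q hq).2 hu))⟩, hs⟩

theorem zero_notMem_under : ((Sum.inr 0, 0) : LinkoidParam 0 (m + 1)) ∉ C.under := fun h => by
  obtain ⟨q, hq⟩ := C.under_crosses _ h
  exact hC.leg_not_crossing q hq

theorem half_notMem_under : ((Sum.inr 0, 1 / 2) : LinkoidParam 0 (m + 1)) ∉ C.under := fun h => by
  obtain ⟨q, hq⟩ := C.under_crosses _ h
  exact hC.head_not_crossing q hq

omit hC in
theorem under_add_int (t : ℝ) (z : ℤ) :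
    ((Sum.inr 0, t + z) : LinkoidParam 0 (m + 1)) ∈ C.under ↔
      ((Sum.inr 0, t) : LinkoidParam 0 (m + 1)) ∈ C.under :=
  (under_same_iff (D := C) (p := (Sum.inr 0, t)) (q := (Sum.inr 0, t + z))
    ⟨rfl, .inr ⟨rfl, z, rfl⟩⟩).symm

theorem one_notMem_under : ((Sum.inr 0, 1) : LinkoidParam 0 (m + 1)) ∉ C.under := fun h => by
  refine hC.zero_notMem_under ((under_add_int 0 1).1 ?_)
  simpa using h

end IsUnderClosure

/- ### The label of the head along the closing arc -/

namespace UnderMoves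

variable (s : L.UnderMoves C)

theorem exists_stage (t : ℝ) : ∃ i : ℕ, ∀ j : Fin s.num, s.time j < t → j.1 < i :=
  ⟨s.num, fun j _ => j.2⟩

open Classical in
/-- The number of moves made before the time `t`. -/
def stage (t : ℝ) : ℕ := Nat.find (s.exists_stage t)

/-- Since the times increase, the moves made before `t` form an initial segment of the indices. -/
theorem lt_stage_iff (t : ℝ) (j : Fin s.num) : j.1 < s.stage t ↔ s.time j < t := by
  classical
  refine ⟨fun h => ?_, Nat.find_spec (s.exists_stage t) j⟩
  by_contra hj
  refine Nat.find_min (s.exists_stage t) h fun k hk => ?_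
  exact s.time_strictMono.lt_iff_lt.1 (hk.trans_le (not_lt.1 hj))

theorem stage_le (t : ℝ) : s.stage t ≤ s.num := by
  classical
  exact Nat.find_min' _ fun j _ => j.2

theorem stage_eq {t : ℝ} {i : ℕ} (hi : i ≤ s.num) (h : ∀ j : Fin s.num, j.1 < i ↔ s.time j < t) :
    s.stage t = i := by
  have key := fun j => (s.lt_stage_iff t j).trans (h j).symm
  have hle := s.stage_le t
  rcases lt_trichotomy (s.stage t) i with hlt | heq | hlt
  · exact absurd ((key ⟨_, hlt.trans_le hi⟩).2 hlt) (lt_irrefl _)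
  · exact heq
  · exact absurd ((key ⟨i, hlt.trans_le hle⟩).1 hlt) (lt_irrefl _)

theorem stage_time (i : Fin s.num) : s.stage (s.time i) = i :=
  s.stage_eq i.2.le fun _ => s.time_strictMono.lt_iff_lt.symm

/-- Only times strictly before the argument are counted, hence the half-open interval: at the time
of a move the head still carries its old label. -/
theorem stage_eq_of_free {a b : ℝ} (hab : a ≤ b) (h : ∀ j, s.time j ∉ Set.Ico a b) :
    s.stage a = s.stage b :=
  s.stage_eq (s.stage_le b) fun j => (s.lt_stage_iff b j).trans
    ⟨fun hj => not_le.1 fun hj' => h j ⟨hj', hj⟩, fun hj => hj.trans_le hab⟩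

/-- The composite of the first `i` steps. -/
def partialMap (i : ℕ) : QuandleInn L.Q := ((List.ofFn s.step).take i).reverse.prod

theorem partialMap_zero : s.partialMap 0 = 1 := rfl

theorem partialMap_succ (i : Fin s.num) :
    s.partialMap (i + 1) = s.step i * s.partialMap i := by
  unfold partialMap
  rw [List.take_add_one, List.getElem?_eq_getElem (by simp)]
  simp

theorem partialMap_num : s.partialMap s.num = s.closingMap := by
  unfold partialMap closingMap
  rw [List.take_of_length_le (by simp)]

theorem step_apply (i : Fin s.num) (x : L.Q) :
    (s.step i : Equiv.Perm L.Q) x =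
      signedAct (C.crossingDet (closureParam (s.overPoint i).1) (Sum.inr 0, s.time i))
        (L.arcGen (s.overPoint i)) x := by
  unfold step signedAct crossingDet
  split_ifs <;> rfl

/-- The label of the head at the time `t`. -/
def headLabel (t : ℝ) : L.Q := (s.partialMap (s.stage t) : Equiv.Perm L.Q) (L.head 0)

theorem headLabel_eq_of_free {a b : ℝ} (hab : a ≤ b) (h : ∀ j, s.time j ∉ Set.Ico a b) :
    s.headLabel a = s.headLabel b := by
  rw [headLabel, headLabel, s.stage_eq_of_free hab h]

theorem time_mem (i : Fin s.num) : s.time i ∈ Set.Ioo (1 / 2 : ℝ) 1 ∧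
    ((Sum.inr 0, s.time i) : LinkoidParam 0 (m + 1)) ∈ C.under := by
  have : s.time i ∈ Set.range s.time := ⟨i, rfl⟩
  rwa [s.range_time] at this

theorem headLabel_half : s.headLabel (1 / 2) = L.head 0 := by
  have : s.stage (1 / 2) = 0 := s.stage_eq (Nat.zero_le _) fun j =>
    ⟨fun h => absurd h (Nat.not_lt_zero _), fun h => absurd (s.time_mem j).1.1 h.not_gt⟩
  rw [headLabel, this, partialMap_zero]
  rfl

theorem headLabel_one :
    s.headLabel 1 = (s.closingMap : Equiv.Perm L.Q) (L.head 0) := by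
  have : s.stage 1 = s.num := s.stage_eq le_rfl fun j =>
    ⟨fun _ => (s.time_mem j).1.2, fun _ => j.2⟩
  rw [headLabel, this, partialMap_num]

theorem headLabel_crossing (i : Fin s.num) {c : ℝ} (hc : s.time i < c)
    (h : ∀ j, s.time j ∉ Set.Ioo (s.time i) c) :
    s.headLabel c =
      signedAct (C.crossingDet (closureParam (s.overPoint i).1) (Sum.inr 0, s.time i))
        (L.arcGen (s.overPoint i)) (s.headLabel (s.time i)) := by
  have : s.stage c = i + 1 := s.stage_eq i.2 fun j => by
    rw [Nat.lt_succ_iff]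
    refine ⟨fun hj => (s.time_strictMono.monotone hj).trans_lt hc, fun hj => ?_⟩
    exact s.time_strictMono.le_iff_le.1 (not_lt.1 fun hj' => h j ⟨hj', hj⟩)
  rw [headLabel, headLabel, this, stage_time, partialMap_succ, ← step_apply]
  rfl

/-- There are only finitely many moves, so points of the closing arc just before the `i`-th one have
no other move in between. -/
theorem exists_free_left (i : Fin s.num) :
    ∃ a ∈ Set.Ioo (1 / 2) (s.time i), ∀ j, s.time j ∉ Set.Ico a (s.time i) := by
  have h₁ : ∀ᶠ a in nhdsWithin (s.time i) (Set.Iio (s.time i)),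
      ∀ j, s.time j ∉ Set.Ico a (s.time i) := by
    refine Filter.eventually_all.2 fun j => ?_
    by_cases hj : s.time j < s.time i
    · filter_upwards [Ioo_mem_nhdsLT hj] with a ha h
      exact absurd h.1 ha.1.not_ge
    · exact Filter.Eventually.of_forall fun a h => hj h.2
  obtain ⟨a, ha, ha'⟩ := (h₁.and (Ioo_mem_nhdsLT (s.time_mem i).1.1)).exists
  exact ⟨a, ha', ha⟩

end UnderMoves

/-! ### The closing relation holds in the quandle of the closure, and its generators come from the
diagram -/

namespace IsUnderClosure

variable (hC : L.IsUnderClosure C) (s : L.UnderMoves C)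
include hC

theorem exists_time_eq {t : ℝ} (ht : t ∈ Set.Icc (1 / 2 : ℝ) 1)
    (hu : ((Sum.inr 0, t) : LinkoidParam 0 (m + 1)) ∈ C.under) : ∃ i, s.time i = t := by
  have : t ∈ Set.range s.time := by
    rw [s.range_time]
    refine ⟨⟨lt_of_le_of_ne ht.1 ?_, lt_of_le_of_ne ht.2 ?_⟩, hu⟩
    · rintro rfl
      exact hC.half_notMem_under hu
    · rintro rfl
      exact hC.one_notMem_under hu
  exact this

/-- Induction on the number of moves already made. With none, the point lies on the arc of the head.
Otherwise the crossing relation at the last move compares it with a point just before that move. -/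
theorem arcGen_closing : ∀ (k : ℕ) (p : C.ArcPoint), p.1.1 = Sum.inr 0 →
    p.1.2 ∈ Set.Icc (1 / 2 : ℝ) 1 → s.stage p.1.2 = k →
    C.arcGen p = hC.closureHom (s.headLabel p.1.2) := by
  intro k
  induction k with
  | zero =>
    rintro ⟨⟨c, t⟩, hp⟩ hc ht hk
    dsimp only at hc ht hk ⊢
    subst hc
    have hlt : ∀ j, ¬ s.time j < t := fun j hj => by
      have := (s.lt_stage_iff t j).2 hj
      omega
    rw [← s.headLabel_eq_of_free ht.1 fun j hj => hlt j hj.2, s.headLabel_half]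
    refine (C.isColoring_arcGen.arc (hC.closurePoint (L.headPoint 0))
      ⟨(Sum.inr 0, t), hp⟩ rfl ht.1 ?_).symm
    intro x hx hu
    obtain ⟨j, rfl⟩ := hC.exists_time_eq s ⟨hx.1, hx.2.trans ht.2⟩ hu
    obtain h | rfl := hx.2.lt_or_eq
    · exact hlt j h
    · exact hp.2 hu
  | succ k ih =>
    rintro ⟨⟨c, t⟩, hp⟩ hc ht hk
    dsimp only at hc ht hk ⊢
    subst hc
    -- The last of the `k + 1` moves made before `t` has index `k`.
    let i : Fin s.num := ⟨k, by have := s.stage_le t; omega⟩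
    have hit : s.time i < t := (s.lt_stage_iff t i).1 (by simp [i, hk])
    obtain ⟨a, ha, hfree⟩ := s.exists_free_left i
    have hi := (s.time_mem i).1
    have left_free : ∀ x ∈ Set.Ico a (s.time i),
        ((Sum.inr 0, x) : LinkoidParam 0 (m + 1)) ∉ C.under := by
      intro x hx hu
      obtain ⟨j, rfl⟩ := hC.exists_time_eq s ⟨ha.1.le.trans hx.1, hx.2.le.trans hi.2.le⟩ hu
      exact hfree j hx
    have hno : ∀ j, s.time j ∉ Set.Ioo (s.time i) t := fun j hj => by
      have h₁ := (s.lt_stage_iff t j).2 hj.2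
      have h₂ : i < j := s.time_strictMono.lt_iff_lt.1 hj.1
      have h₃ : k < j.1 := h₂
      omega
    have right_free : ∀ x ∈ Set.Ioc (s.time i) t,
        ((Sum.inr 0, x) : LinkoidParam 0 (m + 1)) ∉ C.under := by
      intro x hx hu
      obtain ⟨j, rfl⟩ := hC.exists_time_eq s ⟨hi.1.le.trans hx.1.le, hx.2.trans ht.2⟩ hu
      obtain h | rfl := hx.2.lt_or_eq
      · exact hno j ⟨hx.1, h⟩
      · exact hp.2 hu
    have ea := ih ⟨(Sum.inr 0, a), LinkoidParam.valid_of_closed _, left_free a ⟨le_rfl, ha.2⟩⟩ rfl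
      ⟨ha.1.le, ha.2.le.trans hi.2.le⟩
      ((s.stage_eq_of_free ha.2.le hfree).trans (s.stage_time i))
    refine (C.isColoring_arcGen.crossing (Sum.inr 0, s.time i) (hC.closurePoint (s.overPoint i))
      ⟨(Sum.inr 0, a), LinkoidParam.valid_of_closed _, left_free a ⟨le_rfl, ha.2⟩⟩
      ⟨(Sum.inr 0, t), hp⟩ (s.crosses i)
      ⟨(s.time_mem i).2, rfl, ha.2, left_free, rfl, hit, right_free⟩).trans ?_
    rw [ea, s.headLabel_eq_of_free ha.2.le hfree, s.headLabel_crossing i hit hno,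
      ShelfHom.map_signedAct]
    rfl

/-- The closing relation holds in the fundamental quandle of the closure. -/
theorem closureHom_closing :
    hC.closureHom ((s.closingMap : Equiv.Perm L.Q) (L.head 0)) = hC.closureHom (L.leg 0) := by
  rw [← s.headLabel_one, ← hC.arcGen_closing s _
    ⟨(Sum.inr 0, 1), LinkoidParam.valid_of_closed _, hC.one_notMem_under⟩ rfl
    ⟨by norm_num, le_rfl⟩ rfl]
  -- The closing arc ends at parameter `1`, which is the leg at parameter `0` modulo the period.
  refine C.isColoring_arcGen.same _ (hC.closurePoint (L.legPoint 0)) ⟨rfl, .inr ⟨rfl, -1, ?_⟩⟩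
  simp [closurePoint, legPoint, closureParam]

include s in
theorem exists_closureHom_eq (p : C.ArcPoint) : ∃ x, hC.closureHom x = C.arcGen p := by
  obtain ⟨t, ht, hs⟩ | ⟨q, hq, hs⟩ := closing_or_closureParam p.1
  · refine ⟨s.headLabel t, ?_⟩
    rw [C.isColoring_arcGen.same p ⟨(Sum.inr 0, t), LinkoidParam.valid_of_closed _,
      fun h => p.2.2 (under_same hs.symm h)⟩ hs]
    exact (hC.arcGen_closing s _ ⟨(Sum.inr 0, t), _⟩ rfl ⟨ht.1.le, ht.2.le⟩ rfl).symm
  · have hu : q ∉ L.under := fun hu => p.2.2 (under_same hs.symm ((hC.under_iff q hq).2 hu))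
    exact ⟨L.arcGen ⟨q, hq, hu⟩,
      (C.isColoring_arcGen.same p (hC.closurePoint ⟨q, hq, hu⟩) hs).symm⟩

include s in
-- All generators of the closure's quandle lie in the image of `closureHom`; this gives the
-- uniqueness half of the universal property.
theorem hom_ext {X : Type} [Quandle X] {g₁ g₂ : C.Q →◃ X}
    (h : ∀ x, g₁ (hC.closureHom x) = g₂ (hC.closureHom x)) (y) : g₁ y = g₂ y := by
  refine Q_hom_ext (fun p => ?_) y
  obtain ⟨x, hx⟩ := hC.exists_closureHom_eq s p
  rw [← hx, h]

end IsUnderClosure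

end LinkoidDiagram

namespace LinkoidDiagram

variable {m : ℕ} {L : LinkoidDiagram 1 m} {C : LinkoidDiagram 0 (m + 1)}
  {X : Type} [Quandle X]

/- ### Extending a colouring to the closure -/

open Classical in
/-- The generator of the arc through a point, with a junk value at underpasses. -/
def label (L : LinkoidDiagram 1 m) (p : LinkoidParam 1 m) : L.Q :=
  if h : p.Valid ∧ p ∉ L.under then L.arcGen ⟨p, h⟩ else L.leg 0

theorem label_arcPoint (p : L.ArcPoint) : L.label p.1 = L.arcGen p :=
  dif_pos p.2

namespace UnderMoves

variable (s : L.UnderMoves C) (g : L.Q →◃ X)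

open Classical in
/-- The extension of a colouring to the component of the closure that contains the closing arc,
on a fundamental domain. -/
def extendOpen (t : ℝ) : X :=
  if t ≤ 1 / 2 then g (L.label (Sum.inl 0, 2 * t)) else g (s.headLabel t)

/-- The extension of a colouring to the closure. -/
def extend : LinkoidParam 0 (m + 1) → X
  | (Sum.inl i, _) => i.elim0
  | (Sum.inr c, t) => Fin.cases (motive := fun _ => X) (s.extendOpen g (Int.fract t))
      (fun k => g (L.label (Sum.inr k, t))) c

theorem extend_zero (t : ℝ) : s.extend g (Sum.inr 0, t) = s.extendOpen g (Int.fract t) := rfl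

theorem extendOpen_half_mul {t : ℝ} (ht : t ≤ 1 / 2)
    (hp : LinkoidParam.Valid (Sum.inl 0, 2 * t) ∧ (Sum.inl 0, 2 * t) ∉ L.under) :
    s.extendOpen g t = g (L.arcGen ⟨(Sum.inl 0, 2 * t), hp⟩) := by
  rw [extendOpen, if_pos ht, label, dif_pos hp]

theorem extendOpen_closing {t : ℝ} (ht : 1 / 2 < t) :
    s.extendOpen g t = g (s.headLabel t) := by
  rw [extendOpen, if_neg ht.not_ge]

end UnderMoves

namespace IsUnderClosure

variable (hC : L.IsUnderClosure C) (s : L.UnderMoves C) (g : L.Q →◃ X)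

include hC in
theorem under_half {t : ℝ} (ht : t ∈ Set.Icc (0 : ℝ) 1) :
    ((Sum.inr 0, t / 2) : LinkoidParam 0 (m + 1)) ∈ C.under ↔
      ((Sum.inl 0, t) : LinkoidParam 1 m) ∈ L.under :=
  hC.under_iff (Sum.inl 0, t) fun _ => ht

include hC in
theorem under_two_mul {t : ℝ} (ht : t ∈ Set.Icc (0 : ℝ) (1 / 2)) :
    ((Sum.inl 0, 2 * t) : LinkoidParam 1 m) ∈ L.under ↔
      ((Sum.inr 0, t) : LinkoidParam 0 (m + 1)) ∈ C.under := by
  rw [← hC.under_half ⟨by linarith [ht.1], by linarith [ht.2]⟩, mul_div_cancel_left₀ _ two_ne_zero]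

include hC in
theorem extendOpen_eq_arcGen {t : ℝ} (ht : t ∈ Set.Icc (0 : ℝ) (1 / 2))
    (hu : ((Sum.inr 0, t) : LinkoidParam 0 (m + 1)) ∉ C.under) :
    ∃ hp, s.extendOpen g t = g (L.arcGen ⟨(Sum.inl 0, 2 * t), hp⟩) :=
  ⟨⟨fun _ => ⟨by dsimp only; linarith [ht.1], by dsimp only; linarith [ht.2]⟩,
    fun h => hu ((hC.under_two_mul ht).1 h)⟩, s.extendOpen_half_mul g ht.2 _⟩

include hC in
-- The interval may run through the head at `1/2`, where the definition of `extendOpen` changes. It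
-- is split there, and the two rules agree because the running label starts at `h`.
theorem extendOpen_eq_of_free {a b : ℝ} (ha : 0 ≤ a) (hab : a ≤ b)
    (h : ∀ t ∈ Set.Icc a b, ((Sum.inr 0, t) : LinkoidParam 0 (m + 1)) ∉ C.under) :
    s.extendOpen g a = s.extendOpen g b := by
  have first : ∀ b', a ≤ b' → b' ≤ b → b' ≤ 1 / 2 → s.extendOpen g a = s.extendOpen g b' := by
    intro b' hab' hb' hb'2
    obtain ⟨hp, ea⟩ := hC.extendOpen_eq_arcGen s g ⟨ha, hab'.trans hb'2⟩ (h a ⟨le_rfl, hab⟩)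
    obtain ⟨hq, eb⟩ := hC.extendOpen_eq_arcGen s g ⟨ha.trans hab', hb'2⟩ (h b' ⟨hab', hb'⟩)
    rw [ea, eb]
    refine congrArg g (L.isColoring_arcGen.arc ⟨_, hp⟩ ⟨_, hq⟩ rfl ?_ ?_)
    · dsimp only; linarith
    · intro t ht hu
      dsimp only at ht hu
      rw [← hC.under_half ⟨by linarith [ht.1], by linarith [ht.2]⟩] at hu
      exact h (t / 2) ⟨by linarith [ht.1], by linarith [ht.2]⟩ hu
  have last : ∀ a', 1 / 2 ≤ a' → a ≤ a' → a' ≤ b → s.headLabel a' = s.headLabel b :=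
    fun a' h₁ h₂ h₃ => s.headLabel_eq_of_free h₃
      fun j hj => h (s.time j) ⟨h₂.trans hj.1, hj.2.le⟩ (s.time_mem j).2
  rcases le_or_gt b (1 / 2) with hb2 | hb2
  · exact first b hab le_rfl hb2
  rcases le_or_gt a (1 / 2) with ha2 | ha2
  · rw [first (1 / 2) ha2 hb2.le le_rfl, s.extendOpen_closing g hb2,
      ← last (1 / 2) le_rfl ha2 hb2.le, s.headLabel_half]
    obtain ⟨hp, e⟩ := hC.extendOpen_eq_arcGen s g (t := 1 / 2) ⟨by norm_num, le_rfl⟩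
      hC.half_notMem_under
    rw [e]
    refine congrArg g (L.isColoring_arcGen.same _ (L.headPoint 0) ⟨rfl, .inl ?_⟩)
    simp [headPoint]
  · rw [s.extendOpen_closing g hb2, s.extendOpen_closing g ha2, last a ha2.le le_rfl hab]

variable (hg : g ((s.closingMap : Equiv.Perm L.Q) (L.head 0)) = g (L.leg 0))

include hC hg in
-- This is where the closing relation enters: it makes the colouring match at the seam, the leg.
theorem extendOpen_one : s.extendOpen g 1 = s.extendOpen g 0 := by
  rw [s.extendOpen_closing g (by norm_num), s.headLabel_one, hg]
  obtain ⟨hp, e⟩ := hC.extendOpen_eq_arcGen s g (t := 0) ⟨le_rfl, by norm_num⟩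
    hC.zero_notMem_under
  rw [e]
  refine congrArg g (L.isColoring_arcGen.same (L.legPoint 0) _ ⟨rfl, .inl ?_⟩)
  simp [legPoint]

include hC hg in
theorem extend_eq_extendOpen {t : ℝ} (n : ℤ) (h : t ∈ Set.Icc (n : ℝ) (n + 1)) :
    s.extend g (Sum.inr 0, t) = s.extendOpen g (t - n) := by
  rw [s.extend_zero]
  obtain h' | rfl := h.2.lt_or_eq
  · have : ⌊t⌋ = n := Int.floor_eq_iff.2 ⟨h.1, h'⟩
    rw [Int.fract, this]
  -- At the right end the fractional part drops to `0`; the equality of the values at `0` and `1`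
  -- compensates.
  · rw [Int.fract_add_one, Int.fract_intCast, add_sub_cancel_left, hC.extendOpen_one s g hg]

include hC hg in
theorem extend_eq_of_free_of_mem (n : ℤ) {a b : ℝ} (ha : n ≤ a) (hab : a ≤ b) (hb : b ≤ n + 1)
    (h : ∀ t ∈ Set.Icc a b, ((Sum.inr 0, t) : LinkoidParam 0 (m + 1)) ∉ C.under) :
    s.extend g (Sum.inr 0, a) = s.extend g (Sum.inr 0, b) := by
  rw [hC.extend_eq_extendOpen s g hg n ⟨ha, hab.trans hb⟩,
    hC.extend_eq_extendOpen s g hg n ⟨ha.trans hab, hb⟩]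
  refine hC.extendOpen_eq_of_free s g (by linarith) (by linarith) fun t ht hu => ?_
  rw [← under_add_int t n] at hu
  exact h _ ⟨by linarith [ht.1], by linarith [ht.2]⟩ hu

include hC hg in
-- In real parameters an arc can pass through the leg, and a component without underpasses allows
-- intervals of any length. The induction cuts the interval at integers, with `k` bounding how many
-- further periods are entered.
theorem extend_eq_of_free (k : ℕ) : ∀ a b : ℝ, a ≤ b → b ≤ ⌊a⌋ + 1 + k →
    (∀ t ∈ Set.Icc a b, ((Sum.inr 0, t) : LinkoidParam 0 (m + 1)) ∉ C.under) →
    s.extend g (Sum.inr 0, a) = s.extend g (Sum.inr 0, b) := by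
  induction k with
  | zero =>
    intro a b hab hb h
    exact hC.extend_eq_of_free_of_mem s g hg ⌊a⌋ (Int.floor_le a) hab (by simpa using hb) h
  | succ k ih =>
    intro a b hab hb h
    rcases le_or_gt b (⌊a⌋ + 1 + k) with hb' | hb'
    · exact ih a b hab hb' h
    · have hx : a ≤ ⌊a⌋ + 1 + k := by
        have := Int.lt_floor_add_one a
        have : (0 : ℝ) ≤ k := k.cast_nonneg
        linarith
      rw [ih a _ hx le_rfl fun t ht => h t ⟨ht.1, ht.2.trans hb'.le⟩]
      refine hC.extend_eq_of_free_of_mem s g hg (⌊a⌋ + 1 + k) (by push_cast; exact le_rfl) hb'.le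
        (by push_cast at hb ⊢; linarith) fun t ht => h t ⟨hx.trans ht.1, ht.2⟩

include hC in
theorem extend_closureParam (p : L.ArcPoint) :
    s.extend g (closureParam p.1) = g (L.arcGen p) := by
  obtain ⟨⟨i | k, t⟩, hp⟩ := p
  · obtain rfl : i = 0 := Subsingleton.elim _ _
    obtain ⟨h₀, h₁⟩ := hp.1 rfl
    dsimp only at h₀ h₁
    have hf : Int.fract (t / 2) = t / 2 :=
      Int.fract_eq_self.2 ⟨by linarith, by linarith⟩
    dsimp only [closureParam]
    rw [s.extend_zero, hf]
    obtain ⟨hq, e⟩ := hC.extendOpen_eq_arcGen s g (t := t / 2) ⟨by linarith, by linarith⟩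
      fun hu => hp.2 ((hC.under_half ⟨h₀, h₁⟩).1 hu)
    rw [e]
    refine congrArg g (L.isColoring_arcGen.same _ _ ⟨rfl, .inl ?_⟩)
    dsimp only
    ring
  · exact congrArg g (label_arcPoint ⟨(Sum.inr k, t), hp⟩)

include hC in
theorem extend_same (p q : C.ArcPoint) (h : p.1.Same q.1) :
    s.extend g p.1 = s.extend g q.1 := by
  obtain ⟨⟨i | c, t⟩, hp⟩ := p
  · exact i.elim0
  obtain ⟨⟨i | c', t'⟩, hq⟩ := q
  · exact i.elim0
  obtain rfl : c = c' := by simpa using h.1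
  induction c using Fin.cases with
  | zero =>
    obtain ⟨-, h | ⟨-, z, h⟩⟩ := h
    · exact congrArg (fun t => s.extend g (Sum.inr 0, t)) h
    · dsimp only at h
      dsimp only
      rw [h, s.extend_zero, s.extend_zero, Int.fract_add_intCast]
  | succ k =>
    have v : ∀ t, LinkoidParam.Valid ((Sum.inr k, t) : LinkoidParam 1 m) := fun t h => by simp at h
    have hp' := fun hu => hp.2 ((hC.under_iff (Sum.inr k, t) (v t)).2 hu)
    have hq' := fun hu => hq.2 ((hC.under_iff (Sum.inr k, t') (v t')).2 hu)
    refine (hC.extend_closureParam s g ⟨(Sum.inr k, t), v t, hp'⟩).trans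
      (Eq.trans ?_ (hC.extend_closureParam s g ⟨(Sum.inr k, t'), v t', hq'⟩).symm)
    exact congrArg g (L.isColoring_arcGen.same _ _ ⟨rfl, h.2⟩)

include hC in
-- The under-strand is an old closed component and the over-strand comes from `L`, so the crossing
-- already belongs to `L`.
theorem extend_crossing_succ (k : Fin m) (t : ℝ) (o : C.ArcPoint)
    (ho : LinkoidParam.Crosses C.curve (Sum.inr k.succ, t) o.1) (a c : C.ArcPoint)
    (h : C.Flanks (Sum.inr k.succ, t) a c) :
    s.extend g c.1 =
      signedAct (C.crossingDet o.1 (Sum.inr k.succ, t)) (s.extend g o.1) (s.extend g a.1) := by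
  obtain ⟨o', hs⟩ := hC.exists_over ho
  have v : ∀ t, LinkoidParam.Valid ((Sum.inr k, t) : LinkoidParam 1 m) := fun t h => by simp at h
  obtain ⟨⟨a₁, a₂⟩, ha⟩ := a
  obtain ⟨⟨c₁, c₂⟩, hc⟩ := c
  obtain ⟨hu, h₁, h₂, h₃, h₄, h₅, h₆⟩ := h
  dsimp only at h₁ h₂ h₃ h₄ h₅ h₆
  subst h₁
  subst h₄
  have under_iff : ∀ t, ((Sum.inr k.succ, t) : LinkoidParam 0 (m + 1)) ∈ C.under ↔
    (Sum.inr k, t) ∈ L.under := fun t => hC.under_iff (Sum.inr k, t) (v t)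
  have ho' : LinkoidParam.Crosses L.curve (Sum.inr k, t) o'.1 :=
    (hC.crosses_iff (v t) o'.2.1).1 (crosses_same_right hs ho)
  obtain ⟨r, hr, er⟩ := hC.crossingDet_eq ho'
  have key := L.isColoring_arcGen.crossing (Sum.inr k, t) o'
    ⟨(Sum.inr k, a₂), v _, fun hu => ha.2 ((under_iff _).2 hu)⟩
    ⟨(Sum.inr k, c₂), v _, fun hu => hc.2 ((under_iff _).2 hu)⟩ ho'
    ⟨(under_iff _).1 hu, rfl, h₂, fun x hx hxu => h₃ x hx ((under_iff _).2 hxu), rfl, h₅,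
      fun x hx hxu => h₆ x hx ((under_iff _).2 hxu)⟩
  have key' := congrArg g key
  rw [ShelfHom.map_signedAct, er, signedAct_mul hr] at key'
  rw [hC.extend_same s g o (hC.closurePoint o') hs, crossingDet_same hs (.refl _)]
  refine (hC.extend_closureParam s g
    ⟨(Sum.inr k, c₂), v _, fun hu => hc.2 ((under_iff _).2 hu)⟩).trans (key'.trans ?_)
  exact congrArg₂ (signedAct _) (hC.extend_closureParam s g o').symm
    (hC.extend_closureParam s g ⟨(Sum.inr k, a₂), _⟩).symm

include hC in
-- A crossing before `1/2` belongs to `L`, where `g` respects its relation. One after `1/2` is a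
-- move, and the running label was defined to change by that relation. The head itself is no
-- crossing.
theorem extendOpen_crossing {v : ℝ} (hv : v ∈ Set.Ioo (0 : ℝ) 1) (o : L.ArcPoint)
    (ho : LinkoidParam.Crosses C.curve (Sum.inr 0, v) (closureParam o.1))
    (hu : ((Sum.inr 0, v) : LinkoidParam 0 (m + 1)) ∈ C.under) :
    ∃ ε > 0, ∀ a c : ℝ, v - ε < a → a < v → v < c → c < v + ε →
      (∀ t ∈ Set.Ico a v, ((Sum.inr 0, t) : LinkoidParam 0 (m + 1)) ∉ C.under) →
      (∀ t ∈ Set.Ioc v c, ((Sum.inr 0, t) : LinkoidParam 0 (m + 1)) ∉ C.under) →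
      0 < a ∧ c < 1 ∧
      s.extendOpen g c = signedAct (C.crossingDet (closureParam o.1) (Sum.inr 0, v))
        (g (L.arcGen o)) (s.extendOpen g a) := by
  rcases lt_trichotomy v (1 / 2) with hv2 | rfl | hv2
  -- This `ε` keeps `a` and `c` strictly between the leg and the head.
  · refine ⟨min v (1 / 2 - v), lt_min hv.1 (by linarith), ?_⟩
    intro a c ha hav hvc hc left_free right_free
    have ha0 : 0 < a := by linarith [min_le_left v (1 / 2 - v)]
    have hc2 : c < 1 / 2 := by linarith [min_le_right v (1 / 2 - v)]
    refine ⟨ha0, by linarith, ?_⟩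
    obtain ⟨hp, ea⟩ := hC.extendOpen_eq_arcGen s g ⟨ha0.le, by linarith⟩ (left_free a ⟨le_rfl, hav⟩)
    obtain ⟨hq, ec⟩ := hC.extendOpen_eq_arcGen s g ⟨by linarith, hc2.le⟩ (right_free c ⟨hvc, le_rfl⟩)
    have valid : LinkoidParam.Valid ((Sum.inl 0, 2 * v) : LinkoidParam 1 m) :=
      fun _ => ⟨by dsimp only; linarith, by dsimp only; linarith⟩
    have e : closureParam ((Sum.inl 0, 2 * v) : LinkoidParam 1 m) = (Sum.inr 0, v) := by
      simp [closureParam]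
    rw [← e] at ho ⊢
    have ho' := (hC.crosses_iff valid o.2.1).1 ho
    obtain ⟨r, hr, er⟩ := hC.crossingDet_eq ho'
    rw [ea, ec, ← signedAct_mul hr, ← er, ← ShelfHom.map_signedAct]
    refine congrArg g (L.isColoring_arcGen.crossing _ o _ _ ho' ?_)
    refine ⟨(hC.under_two_mul ⟨hv.1.le, hv2.le⟩).2 hu, rfl, by dsimp only; linarith, ?_, rfl,
      by dsimp only; linarith, ?_⟩
    · intro t ht htu
      dsimp only at ht
      rw [← hC.under_half ⟨by linarith [ht.1], by linarith [ht.2]⟩] at htu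
      exact left_free _ ⟨by linarith [ht.1], by linarith [ht.2]⟩ htu
    · intro t ht htu
      dsimp only at ht
      rw [← hC.under_half ⟨by linarith [ht.1], by linarith [ht.2]⟩] at htu
      exact right_free _ ⟨by linarith [ht.1], by linarith [ht.2]⟩ htu
  · exact absurd hu hC.half_notMem_under
  -- This `ε` keeps `a` and `c` in the interior of the closing arc.
  · refine ⟨min (v - 1 / 2) (1 - v), lt_min (by linarith) (by linarith [hv.2]), ?_⟩
    intro a c ha hav hvc hc left_free right_free
    have ha2 : 1 / 2 < a := by linarith [min_le_left (v - 1 / 2) (1 - v)]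
    have hc1 : c < 1 := by linarith [min_le_right (v - 1 / 2) (1 - v)]
    refine ⟨by linarith, hc1, ?_⟩
    obtain ⟨i, rfl⟩ := hC.exists_time_eq s ⟨hv2.le, hv.2.le⟩ hu
    -- In the absence of triple points, the over-point recorded by the move is the given one.
    have hs : (closureParam (s.overPoint i).1).Same (closureParam o.1) :=
      C.no_triple _ _ _ (s.crosses i) ho
    rw [s.extendOpen_closing g ha2, s.extendOpen_closing g (by linarith),
      s.headLabel_crossing i hvc fun j hj => right_free _ ⟨hj.1, hj.2.le⟩ (s.time_mem j).2,
      s.headLabel_eq_of_free hav.le fun j hj => left_free _ hj (s.time_mem j).2,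
      ShelfHom.map_signedAct, crossingDet_same hs (.refl _),
      L.isColoring_arcGen.same _ _ (same_of_closureParam_same (s.overPoint i).2.1 o.2.1 hs)]

include hC hg in
-- Translation by an integer brings the crossing into one period, away from the seam.
theorem extend_crossing_zero (u : ℝ) (o : C.ArcPoint)
    (ho : LinkoidParam.Crosses C.curve (Sum.inr 0, u) o.1)
    (hu : ((Sum.inr 0, u) : LinkoidParam 0 (m + 1)) ∈ C.under) :
    ∃ ε > 0, ∀ a c : C.ArcPoint, C.Flanks (Sum.inr 0, u) a c → u - ε < a.1.2 → c.1.2 < u + ε →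
      s.extend g c.1 =
        signedAct (C.crossingDet o.1 (Sum.inr 0, u)) (s.extend g o.1) (s.extend g a.1) := by
  obtain ⟨o', hs⟩ := hC.exists_over ho
  obtain ⟨n, v, hv, rfl⟩ : ∃ (n : ℤ) (v : ℝ), v ∈ Set.Ico (0 : ℝ) 1 ∧ u = v + n :=
    ⟨⌊u⌋, Int.fract u, ⟨Int.fract_nonneg u, Int.fract_lt_one u⟩, (Int.fract_add_floor u).symm⟩
  have hu' := (under_add_int v n).1 hu
  have hv' : v ∈ Set.Ioo (0 : ℝ) 1 := by
    refine ⟨lt_of_le_of_ne hv.1 ?_, hv.2⟩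
    rintro rfl
    exact hC.zero_notMem_under hu'
  have hvs : LinkoidParam.Same ((Sum.inr 0, v + n) : LinkoidParam 0 (m + 1)) (Sum.inr 0, v) :=
    ⟨rfl, .inr ⟨rfl, -n, by simp⟩⟩
  obtain ⟨ε, hε, H⟩ := hC.extendOpen_crossing s g hv' o'
    (crosses_same_left hvs (crosses_same_right hs ho)) hu'
  refine ⟨ε, hε, fun a c h ha' hc' => ?_⟩
  obtain ⟨⟨a₁, a₂⟩, ha⟩ := a
  obtain ⟨⟨c₁, c₂⟩, hc⟩ := c
  obtain ⟨-, h₁, h₂, h₃, h₄, h₅, h₆⟩ := h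
  dsimp only at h₁ h₂ h₃ h₄ h₅ h₆ ha' hc'
  subst h₁
  subst h₄
  obtain ⟨ha0, hc1, key⟩ := H (a₂ - n) (c₂ - n) (by linarith) (by linarith) (by linarith)
    (by linarith)
    (fun t ht htu => h₃ (t + n) ⟨by linarith [ht.1], by linarith [ht.2]⟩ ((under_add_int t n).2 htu))
    (fun t ht htu => h₆ (t + n) ⟨by linarith [ht.1], by linarith [ht.2]⟩ ((under_add_int t n).2 htu))
  rw [hC.extend_same s g o (hC.closurePoint o') hs, crossingDet_same hs hvs]
  dsimp only
  rw [hC.extend_eq_extendOpen s g hg n ⟨by linarith, by linarith⟩,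
    hC.extend_eq_extendOpen s g hg n ⟨by linarith, by linarith⟩, key,
    ← hC.extend_closureParam s g]
  rfl

include hC hg in
theorem isColoring_extend : C.IsColoring fun p => s.extend g p.1 := by
  refine .of_near (hC.extend_same s g) ?_ ?_
  · rintro ⟨⟨i | c, a⟩, hp⟩ ⟨⟨c', b⟩, hq⟩ h₁ h₂ h₃
    · exact i.elim0
    dsimp only at h₁ h₂ h₃ ⊢
    subst h₁
    induction c using Fin.cases with
    | zero =>
      obtain ⟨k, hk⟩ := exists_nat_ge (b - (⌊a⌋ + 1))
      exact hC.extend_eq_of_free s g hg k a b h₂ (by linarith) h₃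
    | succ k =>
      have v : ∀ t, LinkoidParam.Valid ((Sum.inr k, t) : LinkoidParam 1 m) :=
        fun t h => by simp at h
      have under_iff : ∀ t, ((Sum.inr k.succ, t) : LinkoidParam 0 (m + 1)) ∈ C.under ↔
        (Sum.inr k, t) ∈ L.under := fun t => hC.under_iff (Sum.inr k, t) (v t)
      have hp' := fun hu => hp.2 ((under_iff a).2 hu)
      have hq' := fun hu => hq.2 ((under_iff b).2 hu)
      refine (hC.extend_closureParam s g ⟨(Sum.inr k, a), v a, hp'⟩).trans
        (Eq.trans ?_ (hC.extend_closureParam s g ⟨(Sum.inr k, b), v b, hq'⟩).symm)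
      exact congrArg g (L.isColoring_arcGen.arc _ _ rfl h₂
        fun t ht htu => h₃ t ht ((under_iff t).2 htu))
  · rintro ⟨i | c, t⟩ o ho hu
    · exact i.elim0
    induction c using Fin.cases with
    | zero => exact hC.extend_crossing_zero s g hg t o ho hu
    | succ k =>
      exact ⟨1, one_pos, fun a c h _ _ => hC.extend_crossing_succ s g k t o ho a c h⟩

include hC hg in
/-- The fundamental quandle of the closure is the quotient of that of the diagram by the closing
relation. -/
theorem exists_extension : ∃ g' : C.Q →◃ X, ∀ x, g' (hC.closureHom x) = g x := by
  refine ⟨(hC.isColoring_extend s g hg).lift, fun x => ?_⟩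
  refine Q_hom_ext (g₁ := (hC.isColoring_extend s g hg).lift.comp hC.closureHom) (fun p => ?_) x
  exact hC.extend_closureParam s g p

end IsUnderClosure

/-- Each closure's quandle has the universal property of a quotient by its closing relation. The
isomorphism and its inverse preserve these relations, so both descend; the composites are identities
by `hom_ext`. -/
theorem nonempty_quandleIso_of_pointedQuandleIso {m' : ℕ} {L' : LinkoidDiagram 1 m'}
    {C' : LinkoidDiagram 0 (m' + 1)} (hC : L.IsUnderClosure C) (hC' : L'.IsUnderClosure C')
    (s : L.UnderMoves C) (s' : L'.UnderMoves C')
    (e : PointedQuandleIso s.pointedQuandle s'.pointedQuandle) :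
    Nonempty (QuandleIso C.Q C'.Q) := by
  let i : L.Q →◃ L'.Q := ⟨e.toFun, e.map_act _ _⟩
  let k : L'.Q → L.Q := e.invFun
  have left_inv : ∀ x, k (i x) = x := e.left_inv
  have right_inv : ∀ x, i (k x) = x := e.right_inv
  let j : L'.Q →◃ L.Q := ⟨k, fun {x y} => by
    conv_lhs => rw [← right_inv x, ← right_inv y, ← i.map_act]
    exact left_inv _⟩
  have i_leg : i (L.leg 0) = L'.leg 0 := e.map_base 0
  have i_head : i ((s.closingMap : Equiv.Perm L.Q) (L.head 0)) =
    (s'.closingMap : Equiv.Perm L'.Q) (L'.head 0) := e.map_base 1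
  have j_leg : j (L'.leg 0) = L.leg 0 := by
    rw [← i_leg]
    exact left_inv _
  have j_head : j ((s'.closingMap : Equiv.Perm L'.Q) (L'.head 0)) =
      (s.closingMap : Equiv.Perm L.Q) (L.head 0) := by
    rw [← i_head]
    exact left_inv _
  obtain ⟨F, hF⟩ := hC.exists_extension s (hC'.closureHom.comp i) (by
    rw [ShelfHom.comp_apply, ShelfHom.comp_apply, i_leg, i_head, hC'.closureHom_closing s'])
  obtain ⟨G, hG⟩ := hC'.exists_extension s' (hC.closureHom.comp j) (by
    rw [ShelfHom.comp_apply, ShelfHom.comp_apply, j_leg, j_head, hC.closureHom_closing s])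
  refine ⟨⟨⟨F, G, fun y => ?_, fun y => ?_⟩, fun _ _ => F.map_act⟩⟩
  · refine hC.hom_ext s (g₁ := G.comp F) (g₂ := ShelfHom.id _) (fun x => ?_) y
    rw [ShelfHom.comp_apply, hF, ShelfHom.comp_apply, hG, ShelfHom.comp_apply]
    exact congrArg hC.closureHom (left_inv x)
  · refine hC'.hom_ext s' (g₁ := F.comp G) (g₂ := ShelfHom.id _) (fun x => ?_) y
    rw [ShelfHom.comp_apply, hG, ShelfHom.comp_apply, hF, ShelfHom.comp_apply]
    exact congrArg hC'.closureHom (right_inv x)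

/- ### Link-type diagrams -/

/-- The closing arc avoids `L`, so it could only cross itself; both strands would then pass under,
which is impossible. -/
theorem IsLinkTypeClosure.notMem_under (hC : L.IsLinkTypeClosure C) {t : ℝ}
    (ht : t ∈ Set.Ioo (1 / 2 : ℝ) 1) :
    ((Sum.inr 0, t) : LinkoidParam 0 (m + 1)) ∉ C.under := fun hu => by
  obtain ⟨q, hq⟩ := C.under_crosses _ hu
  obtain ⟨t', ht', hs⟩ | ⟨q', hv, hs⟩ := closing_or_closureParam q
  · have hqu := hC.arc_under t' ht' _ (crosses_same_left hs hq.symm)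
    exact (C.under_iff _ _ hq).1 hu (under_same hs.symm hqu)
  · refine hC.arc_disjoint t ht ⟨q', hv, ?_⟩
    rw [← hC.curve_eq q' hv, ← (C.curve_same hs).1]
    exact hq.2.2.2.symm

/-- The closing arc of a link-type closure makes no moves. -/
def IsLinkTypeClosure.underMoves (hC : L.IsLinkTypeClosure C) : L.UnderMoves C where
  num := 0
  time i := i.elim0
  time_strictMono i := i.elim0
  range_time := by
    ext t
    simp only [Set.mem_range, IsEmpty.exists_iff, Set.mem_ofPred_eq, false_iff]
    exact fun h => hC.notMem_under h.1 h.2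
  overPoint i := i.elim0
  crosses i := i.elim0

end LinkoidDiagram

end

theorem mainTheorem9 :
    (∀ (m m' : ℕ) (L : LinkoidDiagram 1 m) (L' : LinkoidDiagram 1 m')
      (C : LinkoidDiagram 0 (m + 1)) (C' : LinkoidDiagram 0 (m' + 1)),
      L.IsLinkType → L'.IsLinkType →
      L.IsLinkTypeClosure C → L'.IsLinkTypeClosure C' →
      Nonempty (PointedQuandleIso L.P L'.P) →
      Nonempty (QuandleIso C.Q C'.Q)) ∧
    (∀ (m m' : ℕ) (L : LinkoidDiagram 1 m) (L' : LinkoidDiagram 1 m')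
      (C : LinkoidDiagram 0 (m + 1)) (C' : LinkoidDiagram 0 (m' + 1)),
      L.IsUnderClosure C → L'.IsUnderClosure C' →
      ∀ (s : L.UnderMoves C) (s' : L'.UnderMoves C'),
      Nonempty (PointedQuandleIso s.pointedQuandle s'.pointedQuandle) →
      Nonempty (QuandleIso C.Q C'.Q)) := by
  refine ⟨?_, ?_⟩
  · rintro m m' L L' C C' - - hC hC' ⟨e⟩
    -- Without moves the closing map is the empty product, so the basepoints `l` and `f(h)` reduce
    -- to those of `P(L)`.
    refine LinkoidDiagram.nonempty_quandleIso_of_pointedQuandleIso hC.toIsUnderClosure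
      hC'.toIsUnderClosure hC.underMoves hC'.underMoves ⟨e.toQuandleIso, fun i => ?_⟩
    fin_cases i
    · exact e.map_base 0
    · exact e.map_base 1
  · rintro m m' L L' C C' hC hC' s s' ⟨e⟩
    exact LinkoidDiagram.nonempty_quandleIso_of_pointedQuandleIso hC hC' s s' e
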